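/- There is a function $\varepsilon:(0,\infty)\to(0,\infty)$ with the following property. Let $\Gamma$ be a group of isometries of hyperbolic 3-space $\mathbb H^3$ acting freely and properly discontinuously, such that the hyperbolic 3-manifold $M=\mathbb H^3/\Gamma$ has finite volume, and let $x\in\mathbb H^3$. Let $D=\{y\in\mathbb H^3 : d(x,y)\le d(gx,y)\ \text{for all } g\in\Gamma,\ g\ne 1\}$ be the Dirichlet domain of $\Gamma$ with basepoint $x$, and let $D'=\bigcap_{g\in F}\{y : d(x,y)\le d(gx,y)\}$ be an approximate Dirichlet domain, where $F\subset\Gamma$ is a finite set that contains the elements of some generating set of $\Gamma$ and their inverses. Let $\rho=d(x,\partial D)$ and $\rho'=d(x,\partial D')$ be the injectivity radii of $D$ and of $D'$, that is, the distances from $x$ to their nearest faces. If $\Delta V=\operatorname{vol}(D')-\operatorname{vol}(D)$ satisfies $\Delta V<\varepsilon(\rho')$ or $\Delta V<\varepsilon(\rho)$, then $\rho'=\rho$, and this number is the injectivity radius of $M$ at the image of $x$ (the supremum of all $r$ such that the ball $B(x,r)$ maps injectively to $M$). -/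

import Mathlib

open MeasureTheory
open scoped ENNReal

noncomputable section

/-- Hyperbolic 3-space, upper half-space model: points of Euclidean 3-space with positive last
coordinate. -/
def HypSpace : Type := {p : EuclideanSpace ℝ (Fin 3) // 0 < p 2}

namespace HypSpace

/-- The underlying point of Euclidean 3-space. -/
def toE (p : HypSpace) : EuclideanSpace ℝ (Fin 3) := p.1

/-- The height of a point. -/
def height (p : HypSpace) : ℝ := p.toE 2

theorem height_pos (p : HypSpace) : 0 < p.height := p.2

/-- The hyperbolic distance, `sinh (d / 2) = |p - q| / (2 √(t s))`, equivalently
`cosh d = 1 + |p - q|² / (2 t s)`, where `t`, `s` are the heights of `p`, `q`. -/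
instance : Dist HypSpace :=
  ⟨fun p q => 2 * Real.arsinh (dist p.toE q.toE / (2 * √(p.height * q.height)))⟩

theorem dist_def (p q : HypSpace) :
    dist p q = 2 * Real.arsinh (dist p.toE q.toE / (2 * √(p.height * q.height))) := rfl

theorem sinh_half_dist (p q : HypSpace) :
    Real.sinh (dist p q / 2) = dist p.toE q.toE / (2 * √(p.height * q.height)) := by
  rw [dist_def, mul_div_cancel_left₀ _ two_ne_zero, Real.sinh_arsinh]

/-- Mirror image in the boundary plane (auxiliary for the triangle inequality). -/
def mirror (p : HypSpace) : EuclideanSpace ℝ (Fin 3) := !₂[p.toE 0, p.toE 1, -p.toE 2]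

theorem dist_mirror_sq (p q : HypSpace) :
    dist p.toE q.mirror ^ 2 = dist p.toE q.toE ^ 2 + 4 * (p.height * q.height) := by
  simp only [EuclideanSpace.dist_eq, mirror, height, Fin.sum_univ_three]
  rw [Real.sq_sqrt (by positivity), Real.sq_sqrt (by positivity)]
  simp [Real.dist_eq, sq_abs]
  ring

theorem dist_mirror_comm (p q : HypSpace) : dist p.toE q.mirror = dist q.toE p.mirror := by
  rw [← sq_eq_sq₀ dist_nonneg dist_nonneg, dist_mirror_sq, dist_mirror_sq, dist_comm,
    mul_comm p.height]

theorem dist_self_mirror (p : HypSpace) : dist p.toE p.mirror = 2 * p.height := by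
  have := p.height_pos
  rw [← sq_eq_sq₀ dist_nonneg (by positivity), dist_mirror_sq, dist_self]
  ring

theorem cosh_half_dist (p q : HypSpace) :
    Real.cosh (dist p q / 2) = dist p.toE q.mirror / (2 * √(p.height * q.height)) := by
  have h : 0 < p.height * q.height := mul_pos p.height_pos q.height_pos
  rw [← sq_eq_sq₀ (Real.cosh_pos _).le (by positivity), Real.cosh_sq', sinh_half_dist, div_pow,
    div_pow, dist_mirror_sq, mul_pow, Real.sq_sqrt h.le]
  have h4 : (2 : ℝ) ^ 2 * (p.height * q.height) ≠ 0 := by positivity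
  rw [add_div, show (4 : ℝ) = 2 ^ 2 by norm_num, div_self h4, add_comm]

theorem sinh_half_dist_add_dist (a b c : HypSpace) : Real.sinh ((dist a b + dist b c) / 2) =
    (dist a.toE b.toE * dist c.toE b.mirror + dist b.toE c.toE * dist a.toE b.mirror) /
      (2 * √(a.height * c.height) * dist b.toE b.mirror) := by
  have ha := a.height_pos
  have hb := b.height_pos
  have hc := c.height_pos
  rw [add_div, Real.sinh_add, sinh_half_dist, cosh_half_dist, sinh_half_dist, cosh_half_dist,
    dist_self_mirror, dist_mirror_comm b c, Real.sqrt_mul ha.le, Real.sqrt_mul hb.le,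
    Real.sqrt_mul ha.le]
  have h : b.height = √b.height * √b.height := (Real.mul_self_sqrt hb.le).symm
  rw [show 2 * (√a.height * √c.height) * (2 * b.height) =
    2 * (√a.height * √c.height) * (2 * (√b.height * √b.height)) by rw [← h]]
  field_simp

protected theorem dist_triangle (a b c : HypSpace) : dist a c ≤ dist a b + dist b c := by
  have ha := a.height_pos
  have hb := b.height_pos
  have hc := c.height_pos
  rw [← div_le_div_iff_of_pos_right (zero_lt_two' ℝ), ← Real.sinh_le_sinh, sinh_half_dist,
    sinh_half_dist_add_dist, div_mul_eq_div_div _ _ (dist _ _), le_div_iff₀, div_mul_eq_mul_div]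
  · gcongr
    exact EuclideanGeometry.mul_dist_le_mul_dist_add_mul_dist a.toE b.toE c.toE b.mirror
  · rw [dist_self_mirror]
    positivity

/-- Hyperbolic 3-space with the hyperbolic metric. -/
instance : MetricSpace HypSpace where
  dist := dist
  dist_self p := by simp [dist_def]
  dist_comm p q := by rw [dist_def, dist_def, dist_comm, mul_comm p.height]
  dist_triangle := HypSpace.dist_triangle
  eq_of_dist_eq_zero {p q} h := by
    have h0 : 0 < √(p.height * q.height) :=
      Real.sqrt_pos.2 (mul_pos p.height_pos q.height_pos)
    have h1 := sinh_half_dist p q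
    rw [show dist p q = 0 from h, zero_div, Real.sinh_zero, eq_comm, div_eq_zero_iff] at h1
    rcases h1 with h1 | h1
    · exact Subtype.ext (dist_eq_zero.1 h1)
    · linarith

/-- The Borel structure inherited from Euclidean 3-space. -/
instance : MeasurableSpace HypSpace :=
  inferInstanceAs (MeasurableSpace {p : EuclideanSpace ℝ (Fin 3) // 0 < p 2})

/-- The hyperbolic volume `dx dy dt / t³`. -/
def vol : Measure HypSpace :=
  (Measure.comap toE volume).withDensity fun p => ENNReal.ofReal (1 / p.height ^ 3)

end HypSpace

open HypSpace

/-- The group `Γ` of isometries acts freely and properly discontinuously on hyperbolic 3-space, so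
that the quotient is a hyperbolic 3-manifold. -/
structure IsHypManifoldGroup (Γ : Subgroup (HypSpace ≃ᵢ HypSpace)) : Prop where
  free : ∀ g ∈ Γ, g ≠ 1 → ∀ y, g y ≠ y
  properly_discontinuous : ∀ K L : Set HypSpace, IsCompact K → IsCompact L →
    {g | g ∈ Γ ∧ (g '' K ∩ L).Nonempty}.Finite

/-- The projection of hyperbolic 3-space to its quotient by `Γ` is injective on `U`. -/
def EmbedsInQuotient (Γ : Subgroup (HypSpace ≃ᵢ HypSpace)) (U : Set HypSpace) : Prop :=
  ∀ y ∈ U, ∀ g ∈ Γ, g y ∈ U → g y = y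

/-- The volume of the quotient manifold: the supremum of the volumes of the Borel sets that the
projection maps injectively to it (attained by any Borel set meeting each orbit exactly once). -/
def quotientVolume (Γ : Subgroup (HypSpace ≃ᵢ HypSpace)) : ℝ≥0∞ :=
  ⨆ (U : Set HypSpace) (_ : MeasurableSet U) (_ : EmbedsInQuotient Γ U), vol U

/-- The injectivity radius of the quotient manifold at the image of `x`: the supremum of the radii
of the balls about `x` that the projection maps injectively to the quotient. -/
def injRadiusAt (Γ : Subgroup (HypSpace ≃ᵢ HypSpace)) (x : HypSpace) : ℝ :=
  sSup {r : ℝ | EmbedsInQuotient Γ (Metric.ball x r)}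

/-- The half-space of points that are at least as close to `x` as to `g x`. -/
def dirichletHalfSpace (x : HypSpace) (g : HypSpace ≃ᵢ HypSpace) : Set HypSpace :=
  {y | dist x y ≤ dist (g x) y}

/-- The Dirichlet domain of `Γ` with basepoint `x`. -/
def dirichletDomain (Γ : Subgroup (HypSpace ≃ᵢ HypSpace)) (x : HypSpace) : Set HypSpace :=
  {y | ∀ g ∈ Γ, g ≠ 1 → dist x y ≤ dist (g x) y}

/-- `D'` is an approximate Dirichlet domain of `Γ` with basepoint `x`: the intersection of the
half-spaces of finitely many elements of `Γ`, among them the elements of a generating set of `Γ`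
and their inverses. -/
def IsApproxDirichletDomain (Γ : Subgroup (HypSpace ≃ᵢ HypSpace)) (x : HypSpace)
    (D' : Set HypSpace) : Prop :=
  ∃ F S : Set (HypSpace ≃ᵢ HypSpace), F.Finite ∧ F ⊆ (Γ : Set (HypSpace ≃ᵢ HypSpace)) ∧
    Subgroup.closure S = Γ ∧ (∀ g ∈ S, g ∈ F ∧ g⁻¹ ∈ F) ∧ D' = ⋂ g ∈ F, dirichletHalfSpace x g

/-- The injectivity radius read off from a polyhedron `P` with basepoint `x`: the distance from
`x` to the boundary, that is, to the nearest face, of `P`. -/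
def domainInjRadius (x : HypSpace) (P : Set HypSpace) : ℝ :=
  Metric.infDist x (frontier P)

end

/-! Let `2σ` and `2σ'` be the least displacements of `x` under the nontrivial elements of `Γ` and of
`F`. The radii read off from `D` and `D'` are `σ` and `σ'` (`domainInjRadius_halfSpaceInter`), and
`σ` is the injectivity radius of the quotient at `x` (`injRadiusAt_eq`). Since `σ ≤ σ'`, only `σ <
σ'` has to be excluded.

In that case let `g` realize `σ`, and let `m` be the midpoint of `x` and `g x`. A small ball just
beyond `m` lies outside `D`. If it left `D'`, some `f ∈ F` would bring `f x` within little more than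
`σ` of `m`. But `x`, `g x` and `f x` are pairwise at least `2σ` apart, so the median of their
triangle from `f x` to `m` is longer than that (`exists_midpoint`, `cosh_add_four_gapRadius_lt`). So
`D' \ D` contains a ball (`exists_ball_subset_diff`) whose radius depends on `σ` alone or on `σ'`
alone, and `ΔV` is at least a lower bound for the volume of balls of that radius
(`ballVolumeBound_le_vol_ball`).

Finite volume makes `vol D` finite and forces `Γ` to be nontrivial. -/

noncomputable section

open HypSpace

namespace HypSpace

/-! ### Hyperboloid coordinates, geodesics and midpoints -/

theorem cosh_dist (p q : HypSpace) :
    Real.cosh (dist p q) = 1 + dist p.toE q.toE ^ 2 / (2 * (p.height * q.height)) := by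
  have h : 0 < p.height * q.height := mul_pos p.height_pos q.height_pos
  have h2 : dist p q = 2 * (dist p q / 2) := by ring
  rw [h2, Real.cosh_two_mul, Real.cosh_sq, sinh_half_dist, div_pow, mul_pow, Real.sq_sqrt h.le]
  field_simp
  ring

theorem dist_toE_sq (p q : HypSpace) : dist p.toE q.toE ^ 2 =
    (p.toE 0 - q.toE 0) ^ 2 + (p.toE 1 - q.toE 1) ^ 2 + (p.height - q.height) ^ 2 := by
  rw [EuclideanSpace.dist_eq, Real.sq_sqrt (by positivity), Fin.sum_univ_three]
  simp [Real.dist_eq, sq_abs, height]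

/-- The Minkowski bilinear form of the hyperboloid model, in light-cone coordinates. -/
theorem cosh_dist_eq_form (p q : HypSpace) : Real.cosh (dist p q) =
    (1 / p.height * ((q.toE 0 ^ 2 + q.toE 1 ^ 2 + q.height ^ 2) / q.height)
      + (p.toE 0 ^ 2 + p.toE 1 ^ 2 + p.height ^ 2) / p.height * (1 / q.height)) / 2
      - p.toE 0 / p.height * (q.toE 0 / q.height)
      - p.toE 1 / p.height * (q.toE 1 / q.height) := by
  have := p.height_pos
  have := q.height_pos
  rw [cosh_dist, dist_toE_sq]
  field_simp
  ring

/-- The point with the given coordinates. -/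
def ofCoords (x y t : ℝ) (ht : 0 < t) : HypSpace := ⟨!₂[x, y, t], by simpa using ht⟩

/-- A point of the hyperboloid in light-cone coordinates is a point of hyperbolic space. -/
theorem exists_cosh_dist_eq (a b₁ b₂ c : ℝ) (ha : 0 < a) (h : a * c = 1 + b₁ ^ 2 + b₂ ^ 2) :
    ∃ z : HypSpace, ∀ y : HypSpace, Real.cosh (dist y z) =
      (1 / y.height * c + (y.toE 0 ^ 2 + y.toE 1 ^ 2 + y.height ^ 2) / y.height * a) / 2
        - y.toE 0 / y.height * b₁ - y.toE 1 / y.height * b₂ := by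
  refine ⟨ofCoords (b₁ / a) (b₂ / a) (1 / a) (by positivity), fun y => ?_⟩
  have := y.height_pos
  have hc : c = (1 + b₁ ^ 2 + b₂ ^ 2) / a := by field_simp; linarith
  rw [cosh_dist_eq_form]
  simp only [ofCoords, toE, height, hc]
  simp
  have : y.1 2 ≠ 0 := y.2.ne'
  field_simp
  ring

/-- The points of the geodesic through two points `p`, `q` at distance `2 ρ`, parametrized by the
signed distance from their midpoint. -/
theorem exists_geodesic_point {p q : HypSpace} {ρ : ℝ} (hρ : 0 < ρ) (hpq : dist p q = 2 * ρ)
    (s : ℝ) : ∃ z : HypSpace, ∀ y : HypSpace, Real.cosh (dist y z) * Real.sinh (2 * ρ) =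
      Real.sinh (ρ - s) * Real.cosh (dist y p) + Real.sinh (ρ + s) * Real.cosh (dist y q) := by
  have hp := p.height_pos
  have hq := q.height_pos
  have hS : 0 < Real.sinh (2 * ρ) := Real.sinh_pos_iff.2 (by linarith)
  have hform := cosh_dist_eq_form p q
  rw [hpq] at hform
  set S := Real.sinh (2 * ρ) with hSdef
  set C := Real.cosh (2 * ρ) with hC
  let a : ℝ → ℝ := fun s => (Real.sinh (ρ - s) * (1 / p.height) +
    Real.sinh (ρ + s) * (1 / q.height)) / S
  let b₁ : ℝ → ℝ := fun s => (Real.sinh (ρ - s) * (p.toE 0 / p.height) +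
    Real.sinh (ρ + s) * (q.toE 0 / q.height)) / S
  let b₂ : ℝ → ℝ := fun s => (Real.sinh (ρ - s) * (p.toE 1 / p.height) +
    Real.sinh (ρ + s) * (q.toE 1 / q.height)) / S
  let c : ℝ → ℝ := fun s => (Real.sinh (ρ - s) *
      ((p.toE 0 ^ 2 + p.toE 1 ^ 2 + p.height ^ 2) / p.height) +
    Real.sinh (ρ + s) * ((q.toE 0 ^ 2 + q.toE 1 ^ 2 + q.height ^ 2) / q.height)) / S
  -- This says that the combination of `p` and `q` with weights `sinh (ρ ∓ s) / S` has the Minkowski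
  -- norm of a point of the hyperboloid.
  have hid : ∀ s, Real.sinh (ρ - s) ^ 2 + Real.sinh (ρ + s) ^ 2 +
      2 * Real.sinh (ρ - s) * Real.sinh (ρ + s) * C = S ^ 2 := by
    intro s
    have key : ∀ u v : ℝ, Real.sinh u ^ 2 + Real.sinh v ^ 2 +
        2 * Real.sinh u * Real.sinh v * Real.cosh (u + v) = Real.sinh (u + v) ^ 2 := by
      intro u v
      rw [Real.sinh_add, Real.cosh_add]
      linear_combination (-Real.sinh v ^ 2) * Real.cosh_sq u - Real.sinh u ^ 2 * Real.cosh_sq v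
    rw [hSdef, hC, show 2 * ρ = (ρ - s) + (ρ + s) by ring, key]
  have hnorm : ∀ s, a s * c s = 1 + b₁ s ^ 2 + b₂ s ^ 2 := by
    intro s
    have h1 : (Real.sinh (ρ - s) ^ 2 + Real.sinh (ρ + s) ^ 2 +
        2 * Real.sinh (ρ - s) * Real.sinh (ρ + s) * C) / S ^ 2 = 1 := by
      rw [hid, div_self (by positivity)]
    rw [← h1, hform]
    simp only [a, b₁, b₂, c]
    generalize Real.sinh (ρ - s) = u
    generalize Real.sinh (ρ + s) = v
    field_simp
    ring
  -- For `|s| > ρ` one weight is negative, so positivity is not termwise. But `a * c ≥ 1` keeps `a`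
  -- from vanishing, and `a 0 > 0`: by continuity the curve stays on the upper sheet.
  have ha : ∀ s, 0 < a s := by
    intro s
    have hcont : Continuous a := by fun_prop
    have h0 : 0 < a 0 := by
      have : 0 < Real.sinh ρ := Real.sinh_pos_iff.2 hρ
      simp only [a, sub_zero, add_zero]
      positivity
    by_contra! hs
    obtain ⟨r, hr⟩ := mem_range_of_exists_le_of_exists_ge hcont ⟨s, hs⟩ ⟨0, h0.le⟩
    have := hnorm r
    rw [hr] at this
    nlinarith [sq_nonneg (b₁ r), sq_nonneg (b₂ r)]
  obtain ⟨z, hz⟩ := exists_cosh_dist_eq (a s) (b₁ s) (b₂ s) (c s) (ha s) (hnorm s)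
  refine ⟨z, fun y => ?_⟩
  have hy := y.height_pos
  rw [hz, cosh_dist_eq_form, cosh_dist_eq_form]
  simp only [a, b₁, b₂, c]
  generalize Real.sinh (ρ - s) = u
  generalize Real.sinh (ρ + s) = v
  field_simp
  ring

theorem dist_eq_of_cosh_eq {p q : HypSpace} {r : ℝ} (hr : 0 ≤ r)
    (h : Real.cosh (dist p q) = Real.cosh r) : dist p q = r := by
  exact Real.cosh_strictMonoOn.injOn dist_nonneg hr h

theorem dist_lt_dist_iff {p q p' q' : HypSpace} :
    dist p q < dist p' q' ↔ Real.cosh (dist p q) < Real.cosh (dist p' q') := by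
  rw [Real.cosh_lt_cosh, abs_of_nonneg dist_nonneg, abs_of_nonneg dist_nonneg]

/-- The midpoint `m` of `p` and `q`, and the point `z` at distance `s` beyond it. -/
theorem exists_midpoint {p q : HypSpace} {ρ : ℝ} (hρ : 0 < ρ) (hpq : dist p q = 2 * ρ) :
    ∃ m : HypSpace, dist p m = ρ ∧ dist q m = ρ ∧
      (∀ y, 2 * Real.cosh ρ * Real.cosh (dist y m) =
        Real.cosh (dist y p) + Real.cosh (dist y q)) ∧
      ∀ s, 0 < s → ∃ z, dist z m = s ∧ ∀ y, dist y z < s → dist q y < dist p y := by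
  have hs : 0 < Real.sinh ρ := Real.sinh_pos_iff.2 hρ
  have hc := Real.cosh_pos ρ
  have hsq := Real.cosh_sq ρ
  obtain ⟨m, hm⟩ := exists_geodesic_point hρ hpq 0
  have hm' : ∀ y, 2 * Real.cosh ρ * Real.cosh (dist y m) =
      Real.cosh (dist y p) + Real.cosh (dist y q) := by
    intro y
    have := hm y
    rw [Real.sinh_two_mul, sub_zero, add_zero] at this
    apply mul_left_cancel₀ hs.ne'
    linarith
  have hpm : dist p m = ρ := by
    apply dist_eq_of_cosh_eq hρ.le
    have := hm' p
    rw [dist_self, hpq, Real.cosh_two_mul, Real.cosh_zero] at this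
    apply mul_left_cancel₀ hc.ne'
    linarith
  have hqm : dist q m = ρ := by
    apply dist_eq_of_cosh_eq hρ.le
    have := hm' q
    rw [dist_self, dist_comm q p, hpq, Real.cosh_two_mul, Real.cosh_zero] at this
    apply mul_left_cancel₀ hc.ne'
    linarith
  refine ⟨m, hpm, hqm, hm', fun s hs0 => ?_⟩
  obtain ⟨z, hz⟩ := exists_geodesic_point hρ hpq s
  have hss : 0 < Real.sinh s := Real.sinh_pos_iff.2 hs0
  -- Expanding `sinh (ρ ∓ s)` splits off the midpoint term. If `y` is no nearer to `q` than to `p`,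
  -- what remains gives `cosh (dist y z) ≥ cosh s * cosh (dist y m) ≥ cosh s`.
  have hz' : ∀ y, 2 * Real.sinh ρ * Real.cosh (dist y z) =
      2 * Real.sinh ρ * (Real.cosh s * Real.cosh (dist y m)) +
        Real.sinh s * (Real.cosh (dist y q) - Real.cosh (dist y p)) := by
    intro y
    have h1 := hz y
    rw [Real.sinh_two_mul, Real.sinh_sub, Real.sinh_add] at h1
    apply mul_left_cancel₀ hc.ne'
    linear_combination h1 - Real.sinh ρ * Real.cosh s * hm' y
  refine ⟨z, ?_, fun y hy => ?_⟩
  · rw [dist_comm]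
    apply dist_eq_of_cosh_eq hs0.le
    have := hz' m
    rw [dist_self, dist_comm m q, dist_comm m p, hpm, hqm, Real.cosh_zero] at this
    apply mul_left_cancel₀ hs.ne'
    linarith
  · rw [dist_lt_dist_iff, dist_comm q, dist_comm p]
    have h1 := hz' y
    have h2 : Real.cosh (dist y z) < Real.cosh s := by
      rwa [Real.cosh_lt_cosh, abs_of_nonneg dist_nonneg, abs_of_pos hs0]
    have h3 := Real.one_le_cosh (dist y m)
    have h4 := Real.one_le_cosh s
    by_contra! h
    have h5 : 0 ≤ Real.sinh s * (Real.cosh (dist y q) - Real.cosh (dist y p)) := 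
      mul_nonneg hss.le (by linarith)
    have h6 : Real.cosh s * Real.cosh (dist y m) ≤ Real.cosh (dist y z) := by
      apply le_of_mul_le_mul_left _ (show 0 < 2 * Real.sinh ρ by positivity)
      linarith
    nlinarith


/-! ### Measurability, and compactness of closed balls -/

theorem measurableSet_range_toE : MeasurableSet {e : EuclideanSpace ℝ (Fin 3) | 0 < e 2} :=
  measurableSet_lt measurable_const (by fun_prop)

theorem measurableEmbedding_toE : MeasurableEmbedding toE :=
  MeasurableEmbedding.subtype_coe measurableSet_range_toE

theorem measurable_height : Measurable height := by
  have := measurableEmbedding_toE.measurable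
  unfold height
  fun_prop

/-- The measurable structure comes from Euclidean space, so measurability is read off from the
explicit distance formula. -/
theorem measurable_dist_right (p : HypSpace) : Measurable fun y => dist p y := by
  have h1 := measurableEmbedding_toE.measurable
  have h2 := measurable_height
  have h3 : Measurable Real.arsinh := Real.continuous_arsinh.measurable
  simp only [dist_def]
  fun_prop

theorem measurableSet_ball (p : HypSpace) (r : ℝ) : MeasurableSet (Metric.ball p r) := by
  simp only [Metric.ball, dist_comm _ p]
  exact measurableSet_lt (measurable_dist_right p) measurable_const

theorem continuous_dist_toE (p : HypSpace) :
    Continuous fun e : {e : EuclideanSpace ℝ (Fin 3) // 0 < e 2} =>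
      2 * Real.arsinh (dist (e : EuclideanSpace ℝ (Fin 3)) p.toE / (2 * √(e.1 2 * p.height))) := by
  refine continuous_const.mul (Real.continuous_arsinh.comp (Continuous.div ?_ ?_ ?_))
  · fun_prop
  · fun_prop
  · intro e
    have := Real.sqrt_pos.2 (mul_pos e.2 p.height_pos)
    positivity

/-- The identity from the Euclidean half-space to hyperbolic space. -/
def ofSubtype (e : {e : EuclideanSpace ℝ (Fin 3) // 0 < e 2}) : HypSpace := e

theorem continuous_ofSubtype : Continuous ofSubtype := by
  rw [continuous_iff_continuousAt]
  intro e
  rw [ContinuousAt, tendsto_iff_dist_tendsto_zero]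
  have := (continuous_dist_toE (ofSubtype e)).tendsto e
  have h0 : 2 * Real.arsinh (dist (e : EuclideanSpace ℝ (Fin 3)) (ofSubtype e).toE /
      (2 * √(e.1 2 * (ofSubtype e).height))) = 0 := dist_self (ofSubtype e)
  rw [h0] at this
  exact this

theorem height_le (p q : HypSpace) : p.height ≤ 2 * q.height * Real.cosh (dist p q) := by
  have hp := p.height_pos
  have hq := q.height_pos
  have h := cosh_dist p q
  have h2 := dist_toE_sq p q
  have h3 : p.height * p.height ≤ p.height * (2 * q.height * Real.cosh (dist p q)) := by
    have : p.height * (2 * q.height * Real.cosh (dist p q)) =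
        2 * (p.height * q.height) + dist p.toE q.toE ^ 2 := by
      rw [h]
      field_simp
    rw [this, h2]
    nlinarith [sq_nonneg (p.toE 0 - q.toE 0), sq_nonneg (p.toE 1 - q.toE 1), sq_nonneg q.height]
  exact le_of_mul_le_mul_left h3 hp

theorem dist_toE_sq_le (p q : HypSpace) :
    dist p.toE q.toE ^ 2 ≤ (2 * q.height * Real.cosh (dist p q)) ^ 2 := by
  have hp := p.height_pos
  have hq := q.height_pos
  have h := cosh_dist p q
  have hc := Real.cosh_pos (dist p q)
  have h1 := height_le p q
  have : dist p.toE q.toE ^ 2 = 2 * (p.height * q.height) * (Real.cosh (dist p q) - 1) := by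
    rw [h]
    field_simp
    ring
  rw [this]
  have h4 : p.height * q.height ≤ 2 * q.height * Real.cosh (dist p q) * q.height := by gcongr
  nlinarith [mul_pos (mul_pos hp hq) hc, mul_pos hp hq]

/-- Bounds on Euclidean distance and on height place the ball in the continuous image of a Euclidean
compact set that stays away from the boundary plane. Compactness lets proper discontinuity yield
finiteness of orbits in balls. -/
theorem isCompact_closedBall (p : HypSpace) (r : ℝ) : IsCompact (Metric.closedBall p r) := by
  have hp := p.height_pos
  have hc := Real.cosh_pos r
  set K : Set (EuclideanSpace ℝ (Fin 3)) :=
    Metric.closedBall p.toE (2 * p.height * Real.cosh r) ∩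
      {e | p.height / (2 * Real.cosh r) ≤ e 2} with hK
  have hKc : IsCompact K := by
    refine (ProperSpace.isCompact_closedBall _ _).inter_right ?_
    exact isClosed_le continuous_const (by fun_prop)
  have hKr : K ⊆ Set.range (Subtype.val : {e : EuclideanSpace ℝ (Fin 3) // 0 < e 2} → _) := by
    intro e he
    have h2 : p.height / (2 * Real.cosh r) ≤ e 2 := he.2
    exact ⟨⟨e, lt_of_lt_of_le (by positivity) h2⟩, rfl⟩
  have hK' : IsCompact ((Subtype.val : {e : EuclideanSpace ℝ (Fin 3) // 0 < e 2} → _) ⁻¹' K) :=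
    Topology.IsEmbedding.subtypeVal.isInducing.isCompact_preimage' hKc hKr
  refine (hK'.image continuous_ofSubtype).of_isClosed_subset Metric.isClosed_closedBall ?_
  intro q hq
  have hd : dist q p ≤ r := hq
  have hcosh : Real.cosh (dist q p) ≤ Real.cosh r := by
    rw [Real.cosh_le_cosh, abs_of_nonneg dist_nonneg]
    exact hd.trans (le_abs_self r)
  refine ⟨q, ⟨?_, ?_⟩, rfl⟩
  · have := dist_toE_sq_le q p
    rw [Metric.mem_closedBall]
    have h1 := Real.cosh_pos (dist q p)
    exact ((sq_le_sq₀ dist_nonneg (by positivity)).1 this).trans (by gcongr)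
  · have := height_le p q
    rw [dist_comm] at this
    change p.height / (2 * Real.cosh r) ≤ q.height
    rw [div_le_iff₀ (by positivity)]
    have hq := q.height_pos
    nlinarith

/-! ### Bisectors are null sets -/

theorem vol_eq_zero_of_image {A : Set HypSpace} (h : volume (toE '' A) = 0) : vol A = 0 := by
  refine withDensity_absolutelyContinuous _ _ ?_
  rwa [measurableEmbedding_toE.comap_apply]

/-- Bisectors are null sets: in the half-space model they are contained in spheres and planes. -/
theorem vol_bisector {p q : HypSpace} (hpq : p ≠ q) : vol {y | dist p y = dist q y} = 0 := by
  apply vol_eq_zero_of_image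
  have hp := p.height_pos
  have hq := q.height_pos
  have key : ∀ y : HypSpace, dist p y = dist q y →
      q.height * dist y.toE p.toE ^ 2 = p.height * dist y.toE q.toE ^ 2 := by
    intro y hy
    have hy0 := y.height_pos
    have h : Real.cosh (dist p y) = Real.cosh (dist q y) := by rw [hy]
    rw [cosh_dist, cosh_dist, dist_comm p.toE, dist_comm q.toE] at h
    field_simp at h
    linarith
  by_cases hh : p.height = q.height
  · have hne : p.toE ≠ q.toE := fun h => hpq (Subtype.ext h)
    refine measure_mono_null ?_ (Measure.addHaar_affineSubspace volume
      (AffineSubspace.perpBisector p.toE q.toE) ?_)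
    · rintro _ ⟨y, hy, rfl⟩
      have := key y hy
      rw [hh] at this
      rw [SetLike.mem_coe, AffineSubspace.mem_perpBisector_iff_dist_eq]
      have h2 := mul_left_cancel₀ hq.ne' this
      exact (sq_eq_sq₀ dist_nonneg dist_nonneg).1 h2
    · intro h
      rw [AffineSubspace.perpBisector_eq_top] at h
      exact hne h
  · have hd : q.height - p.height ≠ 0 := sub_ne_zero.2 (Ne.symm hh)
    -- The centre of the Apollonius sphere, found by completing the square in `key`.
    set c : EuclideanSpace ℝ (Fin 3) :=
      (q.height - p.height)⁻¹ • (q.height • p.toE - p.height • q.toE) with hc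
    have hball : ∀ y : HypSpace, dist p y = dist q y →
        dist y.toE c ^ 2 = ‖c‖ ^ 2 -
          (q.height * ‖p.toE‖ ^ 2 - p.height * ‖q.toE‖ ^ 2) / (q.height - p.height) := by
      intro y hy
      have h := key y hy
      rw [dist_eq_norm, dist_eq_norm, norm_sub_sq_real, norm_sub_sq_real] at h
      rw [dist_eq_norm, norm_sub_sq_real, hc, inner_smul_right, inner_sub_right,
        inner_smul_right, inner_smul_right]
      field_simp
      linarith
    refine measure_mono_null ?_ (Measure.addHaar_sphere volume c (√(‖c‖ ^ 2 -
      (q.height * ‖p.toE‖ ^ 2 - p.height * ‖q.toE‖ ^ 2) / (q.height - p.height))))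
    rintro _ ⟨y, hy, rfl⟩
    rw [Metric.mem_sphere, ← hball y hy, Real.sqrt_sq dist_nonneg]

/-! ### Lower bounds for volumes of balls -/

/-- The Euclidean radius, relative to the height of the centre, of a Euclidean ball inside the
hyperbolic ball of radius `r`. -/
def innerRadius (r : ℝ) : ℝ := min (1 / 2) (Real.cosh r - 1)

/-- A lower bound for the volume of hyperbolic balls. -/
def ballVolumeBound (r : ℝ) : ℝ :=
  (innerRadius r / (1 + innerRadius r)) ^ 3 *
    (volume (Metric.ball (0 : EuclideanSpace ℝ (Fin 3)) 1)).toReal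

theorem innerRadius_pos {r : ℝ} (hr : 0 < r) : 0 < innerRadius r := by
  have : 1 < Real.cosh r := Real.one_lt_cosh.2 hr.ne'
  exact lt_min (by norm_num) (by linarith)

theorem ballVolumeBound_pos {r : ℝ} (hr : 0 < r) : 0 < ballVolumeBound r := by
  have := innerRadius_pos hr
  refine mul_pos (by positivity) (ENNReal.toReal_pos ?_ ?_)
  · exact (Metric.measure_ball_pos volume _ one_pos).ne'
  · exact measure_ball_lt_top.ne

/-- With `c = innerRadius r ≤ 1 / 2`, heights in the Euclidean ball exceed half that of `p`, so
`cosh d - 1 < c ^ 2 ≤ c ≤ cosh r - 1`. -/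
theorem euclidean_ball_subset (p : HypSpace) {r : ℝ} (hr : 0 < r) :
    toE ⁻¹' Metric.ball p.toE (innerRadius r * p.height) ⊆ Metric.ball p r := by
  intro q hq
  have hp := p.height_pos
  have hq0 := q.height_pos
  have hc := innerRadius_pos hr
  have hc1 : innerRadius r ≤ 1 / 2 := min_le_left _ _
  have hc2 : innerRadius r ≤ Real.cosh r - 1 := min_le_right _ _
  set c := innerRadius r
  have hd : dist q.toE p.toE < c * p.height := hq
  have hd2 : dist q.toE p.toE ^ 2 < (c * p.height) ^ 2 := by
    gcongr
  have h2 := dist_toE_sq q p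
  have habs : |q.height - p.height| < c * p.height := by
    apply abs_lt_of_sq_lt_sq _ (by positivity)
    nlinarith [sq_nonneg (q.toE 0 - p.toE 0), sq_nonneg (q.toE 1 - p.toE 1)]
  have hq1 : p.height / 2 < q.height := by
    have := (abs_lt.1 habs).1
    nlinarith
  rw [Metric.mem_ball, ← abs_of_nonneg (dist_nonneg (x := q)), ← abs_of_pos hr,
    ← Real.cosh_lt_cosh, cosh_dist]
  have : dist q.toE p.toE ^ 2 / (2 * (q.height * p.height)) < c := by
    rw [div_lt_iff₀ (by positivity)]
    have h3 : p.height ^ 2 / 2 < q.height * p.height := by nlinarith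
    have h4 : c * (p.height ^ 2 / 2) < c * (q.height * p.height) := by gcongr
    have h5 : c * (c * p.height ^ 2) ≤ c * (1 / 2 * p.height ^ 2) := by gcongr
    nlinarith
  linarith

/-- On the Euclidean ball of radius `c t` about a point of height `t`, the density is at least `((1
+ c) t)⁻³`. The powers of `t` cancel, making the bound uniform in `p`. -/
theorem ballVolumeBound_le_vol_ball (p : HypSpace) {r : ℝ} (hr : 0 < r) :
    ENNReal.ofReal (ballVolumeBound r) ≤ vol (Metric.ball p r) := by
  have hp := p.height_pos
  have hc := innerRadius_pos hr
  have hc1 : innerRadius r ≤ 1 / 2 := min_le_left _ _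
  set A := toE ⁻¹' Metric.ball p.toE (innerRadius r * p.height) with hA
  have hAm : MeasurableSet A := measurableEmbedding_toE.measurable Metric.isOpen_ball.measurableSet
  refine le_trans ?_ (measure_mono (euclidean_ball_subset p hr))
  have habs : ∀ e : EuclideanSpace ℝ (Fin 3),
      e ∈ Metric.ball p.toE (innerRadius r * p.height) →
      |e 2 - p.height| < innerRadius r * p.height := by
    intro e he
    refine lt_of_le_of_lt ?_ he
    rw [dist_eq_norm]
    exact PiLp.norm_apply_le (e - p.toE) 2
  have himg : toE '' A = Metric.ball p.toE (innerRadius r * p.height) := by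
    rw [hA, Set.image_preimage_eq_iff]
    intro e he
    have := (abs_lt.1 (habs e he)).1
    exact ⟨⟨e, by nlinarith⟩, rfl⟩
  rw [← hA, vol, withDensity_apply _ hAm]
  have hlow : ∀ q ∈ A, ENNReal.ofReal (1 / ((1 + innerRadius r) * p.height) ^ 3) ≤
      ENNReal.ofReal (1 / q.height ^ 3) := by
    intro q hq
    have h1 := (abs_lt.1 (habs _ hq)).2
    have hq0 := q.height_pos
    have h2 : q.height ≤ (1 + innerRadius r) * p.height := by
      change q.height - _ < _ at h1
      linarith
    gcongr
  refine le_trans ?_ (setLIntegral_mono' hAm hlow)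
  rw [setLIntegral_const, measurableEmbedding_toE.comap_apply, himg,
    Measure.addHaar_ball _ _ (by positivity), ballVolumeBound, ENNReal.ofReal_mul (by positivity),
    ENNReal.ofReal_toReal measure_ball_lt_top.ne, ← mul_assoc, ← ENNReal.ofReal_mul (by positivity)]
  gcongr
  simp only [finrank_euclideanSpace, Fintype.card_fin]
  apply le_of_eq
  field_simp


/-- Equally spaced points on the horosphere of height `1` are centres of infinitely many disjoint
balls of equal radius. -/
theorem vol_univ : vol Set.univ = ∞ := by
  let p : ℕ → HypSpace := fun n => ofCoords n 0 1 one_pos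
  have hcosh : ∀ m n, Real.cosh (dist (p m) (p n)) = 1 + ((m : ℝ) - n) ^ 2 / 2 := by
    intro m n
    rw [cosh_dist, dist_toE_sq]
    simp [p, ofCoords, toE, height]
  have hd : 0 < dist (p 0) (p 1) := by
    rw [← dist_self (p 0), dist_lt_dist_iff, hcosh, hcosh]
    norm_num
  have hle : ∀ m n, m ≠ n → dist (p 0) (p 1) ≤ dist (p m) (p n) := by
    intro m n hmn
    by_contra! hlt
    rw [dist_lt_dist_iff, hcosh, hcosh] at hlt
    have h1 : (1 : ℝ) ≤ ((m : ℝ) - n) ^ 2 := by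
      have h2 : (1 : ℤ) ≤ ((m : ℤ) - n) ^ 2 := by
        have h3 : (m : ℤ) - n ≠ 0 := by omega
        have : 0 < ((m : ℤ) - n) ^ 2 := by positivity
        omega
      exact_mod_cast h2
    norm_num at hlt
    linarith
  set r := dist (p 0) (p 1) / 2 with hr
  have hdisj : Pairwise (Function.onFun Disjoint fun n => Metric.ball (p n) r) := by
    intro m n hmn
    refine Metric.ball_disjoint_ball ?_
    have := hle m n hmn
    linarith
  rw [eq_top_iff]
  calc (∞ : ℝ≥0∞) = ∑' _ : ℕ, ENNReal.ofReal (ballVolumeBound r) :=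
        (ENNReal.tsum_const_eq_top_of_ne_zero
          (ENNReal.ofReal_pos.2 (ballVolumeBound_pos (by positivity))).ne').symm
    _ ≤ ∑' n, vol (Metric.ball (p n) r) :=
        ENNReal.tsum_le_tsum fun n => ballVolumeBound_le_vol_ball (p n) (by positivity)
    _ = vol (⋃ n, Metric.ball (p n) r) :=
        (measure_iUnion hdisj fun n => measurableSet_ball (p n) r).symm
    _ ≤ vol Set.univ := measure_mono (Set.subset_univ _)

end HypSpace

/-! ### Intersections of half-spaces -/

theorem quotientVolume_bot : quotientVolume ⊥ = ∞ := by
  rw [eq_top_iff, ← vol_univ]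
  refine le_iSup₂_of_le Set.univ MeasurableSet.univ (le_iSup_of_le ?_ le_rfl)
  intro y _ g hg _
  rw [Subgroup.mem_bot.1 hg]
  rfl

/-- The intersection of the half-spaces of a set of isometries. -/
def halfSpaceInter (x : HypSpace) (A : Set (HypSpace ≃ᵢ HypSpace)) : Set HypSpace :=
  {y | ∀ g ∈ A, dist x y ≤ dist (g x) y}

theorem dirichletDomain_eq_halfSpaceInter (Γ : Subgroup (HypSpace ≃ᵢ HypSpace)) (x : HypSpace) :
    dirichletDomain Γ x = halfSpaceInter x {g | g ∈ Γ ∧ g ≠ 1} := by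
  ext y
  simp [dirichletDomain, halfSpaceInter]

theorem iInter_dirichletHalfSpace (F : Set (HypSpace ≃ᵢ HypSpace)) (x : HypSpace) :
    ⋂ g ∈ F, dirichletHalfSpace x g = halfSpaceInter x {g | g ∈ F ∧ g ≠ 1} := by
  ext y
  simp only [dirichletHalfSpace, halfSpaceInter, Set.mem_iInter, Set.mem_ofPred_eq]
  refine ⟨fun h g hg => h g hg.1, fun h g hg => ?_⟩
  by_cases h1 : g = 1
  · rw [h1]
    exact le_rfl
  · exact h g ⟨hg, h1⟩

theorem ball_subset_halfSpaceInter {x : HypSpace} {A : Set (HypSpace ≃ᵢ HypSpace)} {σ : ℝ}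
    (h : ∀ g ∈ A, 2 * σ ≤ dist x (g x)) : Metric.ball x σ ⊆ halfSpaceInter x A := by
  intro y hy g hg
  have h1 : dist y x < σ := hy
  have h2 := h g hg
  have h3 := dist_triangle x y (g x)
  rw [dist_comm y x] at h1
  rw [dist_comm (g x)]
  linarith

/-- The distance from the basepoint to the boundary of an intersection of half-spaces is half the
least displacement. -/
theorem domainInjRadius_halfSpaceInter {x : HypSpace} {A : Set (HypSpace ≃ᵢ HypSpace)} {σ : ℝ}
    (hσ : 0 < σ) (h : ∀ g ∈ A, 2 * σ ≤ dist x (g x)) {g : HypSpace ≃ᵢ HypSpace} (hg : g ∈ A)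
    (hgx : dist x (g x) = 2 * σ) : domainInjRadius x (halfSpaceInter x A) = σ := by
  obtain ⟨m, hxm, -, -, hm⟩ := exists_midpoint hσ hgx
  have hmem : m ∈ frontier (halfSpaceInter x A) := by
    refine ⟨subset_closure fun f hf => ?_, fun hint => ?_⟩
    · have h1 := h f hf
      have h2 := dist_triangle x m (f x)
      rw [dist_comm (f x)]
      linarith
    · obtain ⟨e, he, hball⟩ := Metric.isOpen_iff.1 isOpen_interior m hint
      -- Points just past `m` towards `g x` are cut off by the half-space of `g`, so `m` is not
      -- interior.
      obtain ⟨z, hzm, hz⟩ := hm (e / 2) (by positivity)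
      have hzP : z ∈ halfSpaceInter x A := interior_subset (hball (by
        rw [Metric.mem_ball, hzm]; linarith))
      have h1 := hzP g hg
      have h2 := hz z (by rw [dist_self]; positivity)
      linarith
  apply le_antisymm
  · exact (Metric.infDist_le_dist_of_mem hmem).trans hxm.le
  · refine (Metric.le_infDist ⟨m, hmem⟩).2 fun y hy => ?_
    by_contra! hlt
    refine hy.2 (interior_maximal (ball_subset_halfSpaceInter h) Metric.isOpen_ball ?_)
    rwa [Metric.mem_ball, dist_comm]

/-! ### Displacements, injectivity radius and volume of the Dirichlet domain -/

namespace IsHypManifoldGroup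

variable {Γ : Subgroup (HypSpace ≃ᵢ HypSpace)}

theorem finite_dist_le (hΓ : IsHypManifoldGroup Γ) (x : HypSpace) (R : ℝ) :
    {g | g ∈ Γ ∧ dist x (g x) ≤ R}.Finite := by
  refine (hΓ.properly_discontinuous {x} (Metric.closedBall x R) isCompact_singleton
    (isCompact_closedBall x R)).subset fun g hg => ⟨hg.1, g x, ⟨x, rfl, rfl⟩, ?_⟩
  rw [Metric.mem_closedBall, dist_comm]
  exact hg.2

theorem countable (hΓ : IsHypManifoldGroup Γ) (x : HypSpace) :
    (Γ : Set (HypSpace ≃ᵢ HypSpace)).Countable := by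
  refine (Set.countable_iUnion fun n : ℕ => (hΓ.finite_dist_le x n).countable).mono fun g hg => ?_
  obtain ⟨n, hn⟩ := exists_nat_ge (dist x (g x))
  exact Set.mem_iUnion.2 ⟨n, hg, hn⟩

theorem exists_min_dist (hΓ : IsHypManifoldGroup Γ) (x : HypSpace)
    {A : Set (HypSpace ≃ᵢ HypSpace)} (hA : ∀ g ∈ A, g ∈ Γ ∧ g ≠ 1) (hne : A.Nonempty) :
    ∃ σ, 0 < σ ∧ (∀ g ∈ A, 2 * σ ≤ dist x (g x)) ∧ ∃ g ∈ A, dist x (g x) = 2 * σ := by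
  obtain ⟨f, hf⟩ := hne
  obtain ⟨g, ⟨hgA, hgf⟩, hmin⟩ := Set.exists_min_image {g | g ∈ A ∧ dist x (g x) ≤ dist x (f x)}
    (fun g => dist x (g x))
    ((hΓ.finite_dist_le x (dist x (f x))).subset fun g hg => ⟨(hA g hg.1).1, hg.2⟩)
    ⟨f, hf, le_rfl⟩
  refine ⟨dist x (g x) / 2, ?_, fun h hh => ?_, g, hgA, by ring⟩
  · have := dist_pos.2 (hΓ.free g (hA g hgA).1 (hA g hgA).2 x).symm
    positivity
  · rw [mul_div_cancel₀ _ two_ne_zero]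
    by_cases hle : dist x (h x) ≤ dist x (f x)
    · exact hmin h ⟨hh, hle⟩
    · exact hgf.trans (le_of_not_ge hle)

theorem injRadiusAt_eq (hΓ : IsHypManifoldGroup Γ) {x : HypSpace} {σ : ℝ} (hσ : 0 < σ)
    (h : ∀ g ∈ Γ, g ≠ 1 → 2 * σ ≤ dist x (g x)) {g : HypSpace ≃ᵢ HypSpace} (hg : g ∈ Γ)
    (hg1 : g ≠ 1) (hgx : dist x (g x) = 2 * σ) : injRadiusAt Γ x = σ := by
  have hset : {r : ℝ | EmbedsInQuotient Γ (Metric.ball x r)} = Set.Iic σ := by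
    ext r
    refine ⟨fun hr => ?_, fun hr y hy f hf hfy => ?_⟩
    · by_contra hlt
      have hlt : σ < r := not_le.1 hlt
      obtain ⟨m, hxm, hgm, -⟩ := exists_midpoint hσ hgx
      have hinv : g (g⁻¹ m) = m := g.apply_symm_apply m
      -- Both `m` and `g⁻¹ m` are at distance `σ` from `x` and `g` identifies them, so no larger
      -- ball embeds.
      have hd : dist (g⁻¹ m) x = σ := by
        rw [← g.dist_eq, hinv, dist_comm, hgm]
      have h1 := hr (g⁻¹ m) (by rw [Metric.mem_ball, hd]; exact hlt) g hg (by
        rw [hinv, Metric.mem_ball, dist_comm, hxm]; exact hlt)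
      exact hΓ.free g hg hg1 _ h1
    · by_contra hne
      have hf1 : f ≠ 1 := fun h1 => hne (by rw [h1]; rfl)
      have h1 := h f hf hf1
      have h2 : dist y x < r := hy
      have h3 : dist (f y) x < r := hfy
      have h4 := dist_triangle x (f y) (f x)
      rw [f.dist_eq, dist_comm x (f y)] at h4
      have h5 : r ≤ σ := hr
      linarith
  rw [injRadiusAt, hset, csSup_Iic]

/-- Strict inequalities define a set that embeds in the quotient. The rest of the domain lies in
countably many bisectors, hence is null. -/
theorem vol_dirichletDomain_le (hΓ : IsHypManifoldGroup Γ) (x : HypSpace) :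
    vol (dirichletDomain Γ x) ≤ quotientVolume Γ := by
  have hcount : {g | g ∈ Γ ∧ g ≠ 1}.Countable := (hΓ.countable x).mono fun g hg => hg.1
  set U : Set HypSpace := ⋂ g ∈ {g | g ∈ Γ ∧ g ≠ 1}, {y | dist x y < dist (g x) y} with hU
  set N : Set HypSpace := ⋃ g ∈ {g | g ∈ Γ ∧ g ≠ 1}, {y | dist x y = dist (g x) y} with hN
  have hUm : MeasurableSet U := MeasurableSet.biInter hcount fun g _ =>
    measurableSet_lt (measurable_dist_right x) (measurable_dist_right (g x))
  have hNz : vol N = 0 := (measure_biUnion_null_iff hcount).2 fun g hg =>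
    vol_bisector (hΓ.free g hg.1 hg.2 x).symm
  have hUe : EmbedsInQuotient Γ U := by
    intro y hy g hg hgy
    by_contra hne
    have hg1 : g ≠ 1 := fun h1 => hne (by rw [h1]; rfl)
    simp only [hU, Set.mem_iInter, Set.mem_ofPred_eq] at hy hgy
    have h1 := hgy g ⟨hg, hg1⟩
    have h2 := hy g⁻¹ ⟨inv_mem hg, inv_ne_one.2 hg1⟩
    have hinv : g (g⁻¹ x) = x := g.apply_symm_apply x
    rw [g.dist_eq] at h1
    rw [← g.dist_eq (g⁻¹ x), hinv] at h2
    linarith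
  have hsub : dirichletDomain Γ x ⊆ U ∪ N := by
    intro y hy
    by_cases hyN : y ∈ N
    · exact Or.inr hyN
    · left
      simp only [hN, Set.mem_iUnion, not_exists] at hyN
      exact Set.mem_iInter₂.2 fun g hg => lt_of_le_of_ne (hy g hg.1 hg.2) (hyN g hg)
  calc vol (dirichletDomain Γ x) ≤ vol (U ∪ N) := measure_mono hsub
    _ ≤ vol U + vol N := measure_union_le _ _
    _ = vol U := by rw [hNz, add_zero]
    _ ≤ quotientVolume Γ := le_iSup₂_of_le U hUm (le_iSup_of_le hUe le_rfl)

end IsHypManifoldGroup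

/-! ### The ball in the gap between the two domains -/

/-- The radius of a ball that fits into the part of an approximate Dirichlet domain cut off by a
missing half-space. -/
def gapRadius (r : ℝ) : ℝ := min (r / 4) (Real.arsinh (Real.tanh (r / 2) / 2) / 4)

theorem tanh_pos_of_pos {r : ℝ} (hr : 0 < r) : 0 < Real.tanh r := by
  rw [Real.tanh_eq_sinh_div_cosh]
  exact div_pos (Real.sinh_pos_iff.2 hr) (Real.cosh_pos r)

theorem tanh_le_tanh_of_le {r s : ℝ} (h : r ≤ s) : Real.tanh r ≤ Real.tanh s := by
  rw [Real.tanh_eq_sinh_div_cosh, Real.tanh_eq_sinh_div_cosh,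
    div_le_div_iff₀ (Real.cosh_pos r) (Real.cosh_pos s)]
  have h1 : 0 ≤ Real.sinh (s - r) := Real.sinh_nonneg_iff.2 (by linarith)
  rw [Real.sinh_sub] at h1
  linarith

theorem gapRadius_pos {r : ℝ} (hr : 0 < r) : 0 < gapRadius r := by
  have h1 := tanh_pos_of_pos (half_pos hr)
  have h2 : 0 < Real.arsinh (Real.tanh (r / 2) / 2) := Real.arsinh_pos_iff.2 (by positivity)
  exact lt_min (by positivity) (by positivity)

/-- For `u = 4 * gapRadius r`, `sinh u ≤ tanh σ / 2`. After expansion the left side is at most `cosh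
σ ^ 2 + (1 / 2 + 1 / 8) * sinh σ ^ 2`, while the right side is `cosh σ ^ 2 + sinh σ ^ 2`. -/
theorem cosh_add_four_gapRadius_lt {σ r : ℝ} (hr : 0 < r) (h : r / 2 ≤ σ) :
    Real.cosh σ * Real.cosh (σ + 4 * gapRadius r) < Real.cosh (2 * σ) := by
  have hσ : 0 < σ := by linarith
  set u := 4 * gapRadius r with hu
  have hu0 : 0 < u := by
    have := gapRadius_pos hr
    positivity
  have hu1 : u ≤ Real.arsinh (Real.tanh (r / 2) / 2) := by
    have : gapRadius r ≤ Real.arsinh (Real.tanh (r / 2) / 2) / 4 := min_le_right _ _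
    linarith
  have hsu : Real.sinh u ≤ Real.tanh σ / 2 := by
    have h1 : Real.sinh u ≤ Real.tanh (r / 2) / 2 := by
      rw [← Real.sinh_arsinh (Real.tanh (r / 2) / 2)]
      exact Real.sinh_le_sinh.2 hu1
    have h2 := tanh_le_tanh_of_le h
    linarith
  have hc := Real.cosh_pos σ
  have hs : 0 < Real.sinh σ := Real.sinh_pos_iff.2 hσ
  have hs0 : 0 < Real.sinh u := Real.sinh_pos_iff.2 hu0
  have hsu' : 2 * (Real.cosh σ * Real.sinh u) ≤ Real.sinh σ := by
    rw [Real.tanh_eq_sinh_div_cosh, le_div_iff₀ two_pos, le_div_iff₀ hc] at hsu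
    linarith
  have hcu : 2 * (Real.cosh u - 1) ≤ Real.sinh u ^ 2 := by
    have := Real.one_le_cosh u
    rw [Real.sinh_sq]
    nlinarith
  rw [Real.cosh_add, Real.cosh_two_mul]
  have h3 : (2 * (Real.cosh σ * Real.sinh u)) ^ 2 ≤ Real.sinh σ ^ 2 := by gcongr
  have h4 : Real.sinh σ * (2 * (Real.cosh σ * Real.sinh u)) ≤ Real.sinh σ * Real.sinh σ := by
    gcongr
  have h5 : Real.cosh σ ^ 2 * (2 * (Real.cosh u - 1)) ≤ Real.cosh σ ^ 2 * Real.sinh u ^ 2 := by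
    gcongr
  nlinarith [mul_pos hs hs]

/-- If the half-space nearest to the basepoint of the Dirichlet domain is missing from the
approximate one, then the difference of the two contains a ball of controlled radius. -/
theorem exists_ball_subset_diff {Γ : Subgroup (HypSpace ≃ᵢ HypSpace)} {x : HypSpace}
    {A : Set (HypSpace ≃ᵢ HypSpace)} {σ σ' r : ℝ} (hA : ∀ g ∈ A, g ∈ Γ ∧ g ≠ 1) (hσ : 0 < σ)
    (hlt : σ < σ') (hr : r = σ ∨ r = σ') (h : ∀ g ∈ Γ, g ≠ 1 → 2 * σ ≤ dist x (g x))
    (hA' : ∀ g ∈ A, 2 * σ' ≤ dist x (g x)) {g : HypSpace ≃ᵢ HypSpace} (hg : g ∈ Γ) (hg1 : g ≠ 1)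
    (hgx : dist x (g x) = 2 * σ) :
    ∃ z, Metric.ball z (gapRadius r) ⊆ halfSpaceInter x A \ dirichletDomain Γ x := by
  have hr0 : 0 < r := by rcases hr with rfl | rfl <;> linarith
  have hη := gapRadius_pos hr0
  obtain ⟨m, hxm, hgm, hmid, hm⟩ := exists_midpoint hσ hgx
  obtain ⟨z, hzm, hz⟩ := hm _ hη
  refine ⟨z, fun y hy => ⟨?_, fun hyD => ?_⟩⟩
  · have hyz : dist y z < gapRadius r := hy
    have hym : dist y m < 2 * gapRadius r := by
      have := dist_triangle y z m
      linarith
    have hyx : dist x y < σ + 2 * gapRadius r := by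
      have := dist_triangle x m y
      rw [dist_comm m y] at this
      linarith
    -- If `σ` is comparable to `r`, the median argument applies. Otherwise `r = σ'` is so large that
    -- the small ball lies in the ball of radius `σ'` about `x`, hence in `D'`.
    by_cases hcase : r / 2 ≤ σ
    · intro f hf
      by_contra! hfy
      -- `g` moves `x` by less than `2 * σ'`, so `f ≠ g`, and minimality of `σ` applies to `f⁻¹ *
      -- g`.
      have hfg : 2 * σ ≤ dist (f x) (g x) := by
        have hne : f⁻¹ * g ≠ 1 := by
          intro h1
          have hfe : f = g := inv_mul_eq_one.1 h1
          have := hA' f hf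
          rw [hfe, hgx] at this
          linarith
        have h1 := h (f⁻¹ * g) (mul_mem (inv_mem (hA f hf).1) hg) hne
        have h2 : f ((f⁻¹ * g) x) = g x := f.apply_symm_apply (g x)
        rwa [← f.dist_eq, h2] at h1
      have hfx : 2 * σ ≤ dist (f x) x := by
        have := hA' f hf
        rw [dist_comm]
        linarith
      have hfm : dist (f x) m < σ + 4 * gapRadius r := by
        have := dist_triangle (f x) y m
        linarith
      have cosh_mono : ∀ {a b : ℝ}, 0 ≤ a → a ≤ b → Real.cosh a ≤ Real.cosh b := by
        intro a b ha hab
        rw [Real.cosh_le_cosh, abs_of_nonneg ha]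
        exact hab.trans (le_abs_self b)
      have h1 := cosh_mono (by positivity) hfx
      have h2 := cosh_mono (by positivity) hfg
      have h3 := cosh_mono dist_nonneg hfm.le
      have h4 := hmid (f x)
      have h5 := cosh_add_four_gapRadius_lt hr0 hcase
      have h6 : Real.cosh σ * Real.cosh (dist (f x) m) ≤
          Real.cosh σ * Real.cosh (σ + 4 * gapRadius r) :=
        mul_le_mul_of_nonneg_left h3 (Real.cosh_pos σ).le
      linarith
    · have hrσ' : r = σ' := hr.resolve_left fun h1 => hcase (by linarith)
      have h4 : gapRadius r ≤ r / 4 := min_le_left _ _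
      refine ball_subset_halfSpaceInter hA' ?_
      rw [Metric.mem_ball, dist_comm]
      linarith
  · have := hyD g hg hg1
    have := hz y hy
    linarith

/-- The admissible excess volume for which the injectivity radius is `r`. -/
def volumeGap (r : ℝ) : ℝ := ballVolumeBound (gapRadius r)

/-- The volume of the difference is at least the volume of a measurable set it contains. -/
theorem ballVolumeBound_le_vol_sub {P Q : Set HypSpace} {z : HypSpace} {r : ℝ} (hr : 0 < r)
    (hPQ : P ⊆ Q) (hP : vol P ≠ ∞) (hz : Metric.ball z r ⊆ Q \ P) :
    ENNReal.ofReal (ballVolumeBound r) ≤ vol Q - vol P := by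
  refine (ballVolumeBound_le_vol_ball z hr).trans (ENNReal.le_sub_of_add_le_left hP ?_)
  rw [← measure_union (Set.disjoint_left.2 fun y hy hyz => (hz hyz).2 hy) (measurableSet_ball z r)]
  exact measure_mono (Set.union_subset hPQ fun y hy => (hz hy).1)

theorem lemma1 :
    ∃ ε : ℝ → ℝ, (∀ r, 0 < r → 0 < ε r) ∧
      ∀ (Γ : Subgroup (HypSpace ≃ᵢ HypSpace)) (x : HypSpace) (D' : Set HypSpace),
        IsHypManifoldGroup Γ → quotientVolume Γ < ∞ → IsApproxDirichletDomain Γ x D' →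
        (HypSpace.vol D' - HypSpace.vol (dirichletDomain Γ x) <
            ENNReal.ofReal (ε (domainInjRadius x D')) ∨
          HypSpace.vol D' - HypSpace.vol (dirichletDomain Γ x) <
            ENNReal.ofReal (ε (domainInjRadius x (dirichletDomain Γ x)))) →
        domainInjRadius x D' = domainInjRadius x (dirichletDomain Γ x) ∧
          domainInjRadius x D' = injRadiusAt Γ x := by
  refine ⟨volumeGap, fun r hr => ballVolumeBound_pos (gapRadius_pos hr), ?_⟩
  rintro Γ x D' hΓ hvol ⟨F, S, -, hFΓ, hS, hSF, rfl⟩ hsmall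
  -- Finiteness makes the truncated subtraction a true difference, even if `vol D' = ∞`.
  have hDfin : vol (dirichletDomain Γ x) ≠ ∞ :=
    ((hΓ.vol_dirichletDomain_le x).trans_lt hvol).ne
  rw [iInter_dirichletHalfSpace] at hsmall ⊢
  set A : Set (HypSpace ≃ᵢ HypSpace) := {g | g ∈ F ∧ g ≠ 1} with hAdef
  have hA : ∀ g ∈ A, g ∈ Γ ∧ g ≠ 1 := fun g hg => ⟨hFΓ hg.1, hg.2⟩
  have hsub : dirichletDomain Γ x ⊆ halfSpaceInter x A := fun y hy g hg =>
    hy g (hA g hg).1 (hA g hg).2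
  -- If `F` held no nontrivial element, the generating set `S` would lie in `{1}` and the quotient
  -- would be all of hyperbolic space, of infinite volume.
  have hAne : A.Nonempty := by
    by_contra hempty
    have hS1 : S ⊆ {1} := fun g hg => by
      by_contra hg1
      exact hempty ⟨g, (hSF g hg).1, hg1⟩
    rw [← hS, Subgroup.closure_eq_bot_iff.2 hS1, quotientVolume_bot] at hvol
    exact lt_irrefl _ hvol
  obtain ⟨σ', hσ', hmin', g', hg', hgx'⟩ := hΓ.exists_min_dist x hA hAne
  obtain ⟨σ, hσ, hmin, g, hg, hgx⟩ := hΓ.exists_min_dist x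
    (A := {g | g ∈ Γ ∧ g ≠ 1}) (fun _ hg => hg) (hAne.mono hA)
  have hD : domainInjRadius x (dirichletDomain Γ x) = σ := by
    rw [dirichletDomain_eq_halfSpaceInter]
    exact domainInjRadius_halfSpaceInter hσ hmin hg hgx
  have hminΓ : ∀ g ∈ Γ, g ≠ 1 → 2 * σ ≤ dist x (g x) := fun g h1 h2 => hmin g ⟨h1, h2⟩
  rw [domainInjRadius_halfSpaceInter hσ' hmin' hg' hgx', hD] at hsmall ⊢
  rw [hΓ.injRadiusAt_eq hσ hminΓ hg.1 hg.2 hgx]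
  suffices σ' = σ from ⟨this, this⟩
  have hle : σ ≤ σ' := by
    have := hmin g' (hA g' hg')
    linarith
  by_contra hne
  have hlt : σ < σ' := lt_of_le_of_ne hle (Ne.symm hne)
  have key : ∀ r, r = σ ∨ r = σ' →
      ENNReal.ofReal (volumeGap r) ≤ vol (halfSpaceInter x A) - vol (dirichletDomain Γ x) := by
    intro r hr
    obtain ⟨z, hz⟩ := exists_ball_subset_diff hA hσ hlt hr hminΓ hmin' hg.1 hg.2 hgx
    have hr0 : 0 < r := by rcases hr with rfl | rfl <;> assumption
    exact ballVolumeBound_le_vol_sub (gapRadius_pos hr0) hsub hDfin hz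
  rcases hsmall with h | h
  · exact absurd h (key σ' (Or.inr rfl)).not_gt
  · exact absurd h (key σ (Or.inl rfl)).not_gt

end
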